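/- Let $0<q<1$. Let $\mathrm{Fun}(U)_q$ be the $*$-algebra over $\mathbb C$ with generators $z,z^*,f_0$ and relations $z^*z=q^2zz^*+1-q^2$, $z^*f_0=f_0z=0$, $f_0^2=f_0=f_0^*$; let $\mathrm{Pol}(\mathbb C)_q$ be its subalgebra generated by $z,z^*$ and $D(U)_q$ its two-sided ideal generated by $f_0$ (the finite functions). On $D(U)_q$ let $\int f\,d\nu=(1-q^2)\,\mathrm{tr}\,T(f(1-zz^*)^{-1})$, where $T$ acts on the space with basis $(v_j)_{j\ge0}$ by $T(z)v_j=v_{j+1}$, $T(z^*)v_j=(1-q^{2j})v_{j-1}$, $T(f_0)v_j=\delta_{j0}v_0$. The differentials $\partial,\bar\partial$ (with $\partial z=dz$, $\partial z^*=0$, $\bar\partial z=0$, $\bar\partial z^*=dz^*$) take values in the bimodule of 1-forms, free as a left module on $dz,dz^*$, in which $dz\cdot z=q^2z\,dz$, $dz\cdot z^*=q^{-2}z^*dz$, $dz^*\cdot z=q^2z\,dz^*$, $dz^*\cdot z^*=q^{-2}z^*dz^*$, and $dz$, $dz^*$ commute with $f_0$; they satisfy the Leibniz rule. The partial derivatives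 are defined by $\bar\partial f=\frac{\partial^{(r)}f}{\partial z^*}\,dz^*$ and $\partial f=dz\,\frac{\partial^{(l)}f}{\partial z}$. The Laplace–Beltrami operator is $\Box=-\bar\partial^*\bar\partial$ with respect to the scalar products $(f,\psi)=\int\psi^*f\,d\nu$ and $(f\,dz^*,\psi\,dz^*)=\int\psi^*f(1-zz^*)^2d\nu$, acting on functions in the sense of distributions: $(\Box f,\psi)=-(\bar\partial f,\bar\partial\psi)$ for all $\psi\in D(U)_q$. A polynomial $g$ is regarded as the distribution $\psi\mapsto\int\psi^*g\,d\nu$ on $D(U)_q$. **Proposition 8.3.** For all polynomials $f_1,f_2$ in one indeterminate with complex coefficients, $$\Box\bigl(f_2(z^*)f_1(z)\bigr)=q^2\,\frac{\partial^{(r)}f_2(z^*)}{\partial z^*}\,(1-zz^*)^2\,\frac{\partial^{(l)}f_1(z)}{\partial z}.$$ -/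

import Mathlib

open Polynomial

noncomputable section

namespace QuantumDisc

/-! Throughout, `q` is a real number with `0 < q < 1`. -/

/-- The deformation parameter: a real number `0 < q < 1`. -/
abbrev Param : Type := Set.Ioo (0 : ℝ) 1

/-- The parameter, viewed as a complex number. -/
def qc (q : Param) : ℂ := ((q : ℝ) : ℂ)

theorem qc_ne_zero (q : Param) : qc q ≠ 0 := by
  have h := q.2.1
  simpa [qc] using h.ne'

theorem one_sub_qc_sq_ne_zero (q : Param) : (1 : ℂ) - qc q ^ 2 ≠ 0 := by
  have h0 := q.2.1
  have h1 := q.2.2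
  have h : (1 : ℝ) - (q : ℝ) ^ 2 ≠ 0 := by nlinarith
  unfold qc
  exact_mod_cast h

theorem star_qc (q : Param) : (starRingEnd ℂ) (qc q) = qc q := Complex.conj_ofReal _

/-! ### The algebra `Fun(U)_q` -/

/-- Names of the generators `z`, `z*`, `f₀`. -/
inductive Gen : Type
  | z : Gen
  | zs : Gen
  | f0 : Gen

open FreeAlgebra in
/-- The defining relations of `Fun(U)_q`:
`z* z = q² z z* + 1 - q²`, `z* f₀ = 0`, `f₀ z = 0`, `f₀² = f₀`. -/
inductive Rel (q : Param) : FreeAlgebra ℂ Gen → FreeAlgebra ℂ Gen → Prop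
  | comm : Rel q (ι ℂ Gen.zs * ι ℂ Gen.z)
      (qc q ^ 2 • (ι ℂ Gen.z * ι ℂ Gen.zs) + algebraMap ℂ _ (1 - qc q ^ 2))
  | zs_f0 : Rel q (ι ℂ Gen.zs * ι ℂ Gen.f0) 0
  | f0_z : Rel q (ι ℂ Gen.f0 * ι ℂ Gen.z) 0
  | f0_f0 : Rel q (ι ℂ Gen.f0 * ι ℂ Gen.f0) (ι ℂ Gen.f0)

/-- The algebra `Fun(U)_q` of functions in the quantum disc, by generators and relations. It
contains the polynomials `Pol(ℂ)_q` and the finite functions `D(U)_q`. -/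
def FunU (q : Param) : Type := RingQuot (Rel q)

instance (q : Param) : Ring (FunU q) := inferInstanceAs (Ring (RingQuot (Rel q)))
instance (q : Param) : Algebra ℂ (FunU q) := inferInstanceAs (Algebra ℂ (RingQuot (Rel q)))

/-- The quotient map from the free algebra. -/
def proj (q : Param) : FreeAlgebra ℂ Gen →ₐ[ℂ] FunU q := RingQuot.mkAlgHom ℂ (Rel q)

/-- The generator `z`. -/
def z (q : Param) : FunU q := proj q (FreeAlgebra.ι ℂ Gen.z)

/-- The generator `z*` (it is the adjoint of `z`, see `star_z`). -/
def zs (q : Param) : FunU q := proj q (FreeAlgebra.ι ℂ Gen.zs)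

/-- The generator `f₀` (an analogue of the delta function at the centre of the disc). -/
def f0 (q : Param) : FunU q := proj q (FreeAlgebra.ι ℂ Gen.f0)

theorem zs_mul_z (q : Param) :
    zs q * z q = qc q ^ 2 • (z q * zs q) + algebraMap ℂ _ (1 - qc q ^ 2) := by
  have h : proj q _ = proj q _ := RingQuot.mkAlgHom_rel ℂ (Rel.comm (q := q))
  simp only [map_mul, map_add, map_smul, AlgHom.commutes] at h
  exact h

theorem zs_mul_f0 (q : Param) : zs q * f0 q = 0 := by
  have h : proj q _ = proj q _ := RingQuot.mkAlgHom_rel ℂ (Rel.zs_f0 (q := q))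
  simp only [map_mul, map_zero] at h
  exact h

theorem f0_mul_z (q : Param) : f0 q * z q = 0 := by
  have h : proj q _ = proj q _ := RingQuot.mkAlgHom_rel ℂ (Rel.f0_z (q := q))
  simp only [map_mul, map_zero] at h
  exact h

theorem f0_mul_f0 (q : Param) : f0 q * f0 q = f0 q := by
  have h : proj q _ = proj q _ := RingQuot.mkAlgHom_rel ℂ (Rel.f0_f0 (q := q))
  simp only [map_mul] at h
  exact h

/-- The images of three generators. -/
def genFun {B : Type*} (a b c : B) : Gen → B
  | Gen.z => a
  | Gen.zs => b
  | Gen.f0 => c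

/-- The universal property of `Fun(U)_q`. -/
def lift (q : Param) {B : Type*} [Ring B] [Algebra ℂ B] (a b c : B)
    (h1 : b * a = qc q ^ 2 • (a * b) + algebraMap ℂ B (1 - qc q ^ 2))
    (h2 : b * c = 0) (h3 : c * a = 0) (h4 : c * c = c) : FunU q →ₐ[ℂ] B :=
  RingQuot.liftAlgHom ℂ ⟨FreeAlgebra.lift ℂ (genFun a b c), by
    intro x y h
    cases h with
    | comm =>
      simpa only [map_mul, map_add, map_smul, AlgHom.commutes, FreeAlgebra.lift_ι_apply, genFun] using h1
    | zs_f0 => simpa only [map_mul, map_zero, FreeAlgebra.lift_ι_apply, genFun] using h2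
    | f0_z => simpa only [map_mul, map_zero, FreeAlgebra.lift_ι_apply, genFun] using h3
    | f0_f0 => simpa only [map_mul, FreeAlgebra.lift_ι_apply, genFun] using h4⟩

section Lift

variable (q : Param) {B : Type*} [Ring B] [Algebra ℂ B] (a b c : B)
    (h1 : b * a = qc q ^ 2 • (a * b) + algebraMap ℂ B (1 - qc q ^ 2))
    (h2 : b * c = 0) (h3 : c * a = 0) (h4 : c * c = c)

theorem lift_z : lift q a b c h1 h2 h3 h4 (z q) = a := by
  have h := RingQuot.liftAlgHom_mkAlgHom_apply (S := ℂ) (s := Rel q)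
    (f := FreeAlgebra.lift ℂ (genFun a b c))
  exact (h _ _).trans (FreeAlgebra.lift_ι_apply _ _)

theorem lift_zs : lift q a b c h1 h2 h3 h4 (zs q) = b := by
  have h := RingQuot.liftAlgHom_mkAlgHom_apply (S := ℂ) (s := Rel q)
    (f := FreeAlgebra.lift ℂ (genFun a b c))
  exact (h _ _).trans (FreeAlgebra.lift_ι_apply _ _)

theorem lift_f0 : lift q a b c h1 h2 h3 h4 (f0 q) = c := by
  have h := RingQuot.liftAlgHom_mkAlgHom_apply (S := ℂ) (s := Rel q)
    (f := FreeAlgebra.lift ℂ (genFun a b c))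
  exact (h _ _).trans (FreeAlgebra.lift_ι_apply _ _)

end Lift

/-- Algebra maps out of `Fun(U)_q` are determined by the images of the generators. -/
theorem hom_ext {q : Param} {B : Type*} [Ring B] [Algebra ℂ B] {φ ψ : FunU q →ₐ[ℂ] B}
    (h1 : φ (z q) = ψ (z q)) (h2 : φ (zs q) = ψ (zs q)) (h3 : φ (f0 q) = ψ (f0 q)) : φ = ψ := by
  refine RingQuot.ringQuot_ext' (S := ℂ) (s := Rel q) φ ψ ?_
  apply FreeAlgebra.hom_ext
  funext x
  cases x
  · exact h1
  · exact h2
  · exact h3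

/-! ### The involution -/

/-- The opposite algebra of `Fun(U)_q`, on which scalars act through complex conjugation. -/
def ConjOp (q : Param) : Type := (FunU q)ᵐᵒᵖ

instance (q : Param) : Ring (ConjOp q) := inferInstanceAs (Ring (FunU q)ᵐᵒᵖ)
instance (q : Param) : Algebra ℂ (ConjOp q) :=
  RingHom.toAlgebra' ((algebraMap ℂ (FunU q)ᵐᵒᵖ).comp (starRingEnd ℂ))
    (fun c x => Algebra.commutes (A := (FunU q)ᵐᵒᵖ) ((starRingEnd ℂ) c) x)

/-- The element of the opposite algebra given by an element of `Fun(U)_q`. -/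
def toConjOp {q : Param} (x : FunU q) : ConjOp q := MulOpposite.op x

/-- The inverse of `toConjOp`. -/
def ofConjOp {q : Param} (x : ConjOp q) : FunU q := MulOpposite.unop (α := FunU q) x

theorem conjOp_algebraMap (q : Param) (c : ℂ) :
    algebraMap ℂ (ConjOp q) c = toConjOp (algebraMap ℂ (FunU q) ((starRingEnd ℂ) c)) := rfl

theorem ofConjOp_smul {q : Param} (c : ℂ) (x : ConjOp q) :
    ofConjOp (c • x) = (starRingEnd ℂ) c • ofConjOp x := by
  rw [Algebra.smul_def, conjOp_algebraMap]
  change ofConjOp x * algebraMap ℂ (FunU q) _ = _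
  rw [← Algebra.commutes, ← Algebra.smul_def]

theorem conjOp_rel (q : Param) : toConjOp (z q) * toConjOp (zs q) =
    qc q ^ 2 • (toConjOp (zs q) * toConjOp (z q)) +
      algebraMap ℂ (ConjOp q) (1 - qc q ^ 2) := by
  apply MulOpposite.unop_injective (α := FunU q)
  change zs q * z q = ofConjOp (_ • _) + ofConjOp (algebraMap ℂ (ConjOp q) _)
  rw [ofConjOp_smul, conjOp_algebraMap, map_pow, map_sub, map_pow, star_qc, map_one]
  exact zs_mul_z q

theorem conjOp_z_f0 (q : Param) : toConjOp (z q) * toConjOp (f0 q) = 0 :=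
  congrArg toConjOp (f0_mul_z q)

theorem conjOp_f0_zs (q : Param) : toConjOp (f0 q) * toConjOp (zs q) = 0 :=
  congrArg toConjOp (zs_mul_f0 q)

theorem conjOp_f0_f0 (q : Param) : toConjOp (f0 q) * toConjOp (f0 q) = toConjOp (f0 q) :=
  congrArg toConjOp (f0_mul_f0 q)

/-- The antilinear antiautomorphism with `z ↦ z*`, `z* ↦ z`, `f₀ ↦ f₀`. -/
def starHom (q : Param) : FunU q →ₐ[ℂ] ConjOp q :=
  lift q (toConjOp (zs q)) (toConjOp (z q)) (toConjOp (f0 q)) (conjOp_rel q) (conjOp_z_f0 q)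
    (conjOp_f0_zs q) (conjOp_f0_f0 q)

/-- The involution of the `*`-algebra `Fun(U)_q`: antilinear, antimultiplicative, exchanging the
generators `z` and `z*`, and fixing `f₀`. -/
def starFun {q : Param} (x : FunU q) : FunU q := ofConjOp (starHom q x)

theorem starFun_add {q : Param} (x y : FunU q) : starFun (x + y) = starFun x + starFun y := by
  unfold starFun
  rw [map_add]
  rfl

theorem starFun_mul {q : Param} (x y : FunU q) : starFun (x * y) = starFun y * starFun x := by
  unfold starFun
  rw [map_mul]
  rfl

theorem starFun_smul {q : Param} (c : ℂ) (x : FunU q) :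
    starFun (c • x) = (starRingEnd ℂ) c • starFun x := by
  unfold starFun
  rw [map_smul, ofConjOp_smul]

theorem starFun_algebraMap (q : Param) (c : ℂ) :
    starFun (algebraMap ℂ (FunU q) c) = algebraMap ℂ (FunU q) ((starRingEnd ℂ) c) := by
  unfold starFun
  rw [AlgHom.commutes, conjOp_algebraMap]
  rfl

theorem starFun_z (q : Param) : starFun (z q) = zs q := by
  unfold starFun starHom
  rw [lift_z]
  rfl

theorem starFun_zs (q : Param) : starFun (zs q) = z q := by
  unfold starFun starHom
  rw [lift_zs]
  rfl

theorem starFun_f0 (q : Param) : starFun (f0 q) = f0 q := by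
  unfold starFun starHom
  rw [lift_f0]
  rfl

theorem starFun_starFun {q : Param} (x : FunU q) : starFun (starFun x) = x := by
  let φ : FunU q →ₐ[ℂ] FunU q :=
    { toFun := fun x => starFun (starFun x)
      map_one' := by
        have h := starFun_algebraMap q 1
        simp only [map_one] at h
        rw [h, h]
      map_mul' := fun x y => by rw [starFun_mul, starFun_mul]
      map_zero' := by
        have h := starFun_algebraMap q 0
        simp only [map_zero] at h
        rw [h, h]
      map_add' := fun x y => by rw [starFun_add, starFun_add]
      commutes' := fun c => by rw [starFun_algebraMap, starFun_algebraMap, Complex.conj_conj] }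
  have h : φ = AlgHom.id ℂ (FunU q) := by
    apply hom_ext
    · change starFun (starFun (z q)) = z q
      rw [starFun_z, starFun_zs]
    · change starFun (starFun (zs q)) = zs q
      rw [starFun_zs, starFun_z]
    · change starFun (starFun (f0 q)) = f0 q
      rw [starFun_f0, starFun_f0]
  exact DFunLike.congr_fun h x

instance (q : Param) : StarRing (FunU q) where
  star := starFun
  star_involutive := starFun_starFun
  star_mul := starFun_mul
  star_add := starFun_add

instance (q : Param) : StarModule ℂ (FunU q) where
  star_smul := starFun_smul

theorem star_z (q : Param) : star (z q) = zs q := starFun_z q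
theorem star_zs (q : Param) : star (zs q) = z q := starFun_zs q
theorem star_f0 (q : Param) : star (f0 q) = f0 q := starFun_f0 q

/-- The `*`-subalgebra `Pol(ℂ)_q` of polynomials, generated by `z` and `z*`. -/
def Pol (q : Param) : Subalgebra ℂ (FunU q) := Algebra.adjoin ℂ {z q, star (z q)}

/-- The element `1 - z z*`. -/
def y (q : Param) : FunU q := 1 - z q * star (z q)

/-! ### Finite functions -/

/-- The space `D(U)_q` of finite functions: the two-sided ideal of `Fun(U)_q` generated by
`f₀`. -/
def DU (q : Param) : Submodule ℂ (FunU q) :=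
  Submodule.span ℂ {x | ∃ a b : FunU q, x = a * f0 q * b}

theorem mem_DU_gen {q : Param} (a b : FunU q) : a * f0 q * b ∈ DU q :=
  Submodule.subset_span ⟨a, b, rfl⟩

theorem mul_mem_DU_left {q : Param} (c : FunU q) {x : FunU q} (hx : x ∈ DU q) :
    c * x ∈ DU q := by
  induction hx using Submodule.span_induction with
  | mem x h =>
    obtain ⟨a, b, rfl⟩ := h
    have h := mem_DU_gen (c * a) b
    simpa only [mul_assoc] using h
  | zero => rw [mul_zero]; exact zero_mem _
  | add x y _ _ hx hy => rw [mul_add]; exact add_mem hx hy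
  | smul r x _ hx => rw [mul_smul_comm]; exact Submodule.smul_mem _ _ hx

theorem mul_mem_DU_right {q : Param} (c : FunU q) {x : FunU q} (hx : x ∈ DU q) :
    x * c ∈ DU q := by
  induction hx using Submodule.span_induction with
  | mem x h =>
    obtain ⟨a, b, rfl⟩ := h
    have h := mem_DU_gen a (b * c)
    simpa only [mul_assoc] using h
  | zero => rw [zero_mul]; exact zero_mem _
  | add x y _ _ hx hy => rw [add_mul]; exact add_mem hx hy
  | smul r x _ hx => rw [smul_mul_assoc]; exact Submodule.smul_mem _ _ hx

theorem star_mem_DU {q : Param} {x : FunU q} (hx : x ∈ DU q) : star x ∈ DU q := by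
  induction hx using Submodule.span_induction with
  | mem x h =>
    obtain ⟨a, b, rfl⟩ := h
    rw [star_mul, star_mul, star_f0, ← mul_assoc]
    exact mem_DU_gen _ _
  | zero => rw [star_zero]; exact zero_mem _
  | add x y _ _ hx hy => rw [star_add]; exact add_mem hx hy
  | smul r x _ hx => rw [star_smul]; exact Submodule.smul_mem _ _ hx

/-! ### The representation `T` and the invariant integral -/

/-- The space `H` of the representation `T`, with basis `v_j = single j 1`. -/
abbrev H : Type := ℕ →₀ ℂ

/-- The basis vector `v_j`. -/
def v (j : ℕ) : H := Finsupp.single j 1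

/-- The operator `v_j ↦ v_{j+1}`. -/
def Tz : Module.End ℂ H := Finsupp.linearCombination ℂ (fun j => v (j + 1))

/-- The operator `v_j ↦ (1 - q^{2j}) v_{j-1}`, `v_0 ↦ 0`. -/
def Tzs (q : Param) : Module.End ℂ H :=
  Finsupp.linearCombination ℂ (fun j => (1 - qc q ^ (2 * j)) • v (j - 1))

/-- The operator `v_0 ↦ v_0`, `v_j ↦ 0` for `j ≠ 0`. -/
def Tf0 : Module.End ℂ H := Finsupp.linearCombination ℂ (fun j => if j = 0 then v 0 else 0)

theorem Tz_v (j : ℕ) : Tz (v j) = v (j + 1) := by simp [Tz, v]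

theorem Tzs_v (q : Param) (j : ℕ) : Tzs q (v j) = (1 - qc q ^ (2 * j)) • v (j - 1) := by
  simp [Tzs, v]

theorem Tf0_v (j : ℕ) : Tf0 (v j) = if j = 0 then v 0 else 0 := by simp [Tf0, v]

theorem end_ext {A B : Module.End ℂ H} (h : ∀ j, A (v j) = B (v j)) : A = B :=
  Finsupp.lhom_ext' fun j => LinearMap.ext_ring (h j)

/-- The representation `T` of `Fun(U)_q` in `H`. -/
def T (q : Param) : FunU q →ₐ[ℂ] Module.End ℂ H :=
  lift q Tz (Tzs q) Tf0
    (by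
      apply end_ext
      intro j
      simp only [Module.End.mul_apply, LinearMap.add_apply, LinearMap.smul_apply, Tz_v, Tzs_v,
        Module.algebraMap_end_apply, map_smul, Nat.add_sub_cancel]
      cases j with
      | zero => simp
      | succ n =>
        simp only [Nat.add_sub_cancel, smul_smul, ← add_smul]
        congr 1
        ring)
    (by
      apply end_ext
      intro j
      rw [Module.End.mul_apply, Tf0_v]
      split_ifs <;> simp [Tzs_v])
    (by
      apply end_ext
      intro j
      rw [Module.End.mul_apply, Tz_v, Tf0_v]
      simp)
    (by
      apply end_ext
      intro j
      rw [Module.End.mul_apply, Tf0_v]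
      split_ifs <;> simp [Tf0_v])

theorem Tf0_apply (w : H) : Tf0 w = w 0 • v 0 := by
  have h : Tf0 = (Finsupp.lapply 0 : H →ₗ[ℂ] ℂ).smulRight (v 0) := by
    apply end_ext
    intro j
    rw [Tf0_v, LinearMap.smulRight_apply, Finsupp.lapply_apply]
    have h : v j 0 = if j = 0 then 1 else 0 := Finsupp.single_apply
    rw [h]
    split_ifs <;> simp
  rw [h]
  rfl

theorem T_f0 (q : Param) : T q (f0 q) = Tf0 := by
  unfold T
  rw [lift_f0]
theorem T_z (q : Param) : T q (z q) = Tz := by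
  unfold T
  rw [lift_z]
theorem T_zs (q : Param) : T q (zs q) = Tzs q := by
  unfold T
  rw [lift_zs]

/-- The diagonal matrix elements of `T(f) T(1 - z z*)⁻¹` in the basis `v_n`; recall that
`T(1 - z z*) v_n = q^{2n} v_n`, see `T_y`. -/
def diagEntry (q : Param) (f : FunU q) (n : ℕ) : ℂ := (qc q ^ (2 * n))⁻¹ * (T q f (v n)) n

theorem T_y (q : Param) (n : ℕ) : T q (y q) (v n) = qc q ^ (2 * n) • v n := by
  rw [y, star_z, map_sub, map_mul, T_z, T_zs, map_one, LinearMap.sub_apply,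
    Module.End.mul_apply, Tzs_v, map_smul, Tz_v]
  cases n with
  | zero => simp
  | succ n => simp [sub_smul]

theorem diagEntry_add (q : Param) (f g : FunU q) :
    diagEntry q (f + g) = diagEntry q f + diagEntry q g := by
  funext n
  simp only [diagEntry, map_add, LinearMap.add_apply, Finsupp.add_apply, Pi.add_apply, mul_add]

theorem diagEntry_smul (q : Param) (c : ℂ) (f : FunU q) :
    diagEntry q (c • f) = c • diagEntry q f := by
  funext n
  simp only [diagEntry, map_smul, LinearMap.smul_apply, Finsupp.smul_apply, Pi.smul_apply,
    smul_eq_mul]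
  ring

theorem finite_support_diagEntry {q : Param} {f : FunU q} (hf : f ∈ DU q) :
    (Function.support (diagEntry q f)).Finite := by
  induction hf using Submodule.span_induction with
  | mem x h =>
    obtain ⟨a, b, rfl⟩ := h
    refine (T q a (v 0)).support.finite_toSet.subset ?_
    intro n hn
    rw [Finset.mem_coe, Finsupp.mem_support_iff]
    intro h0
    apply hn
    simp only [diagEntry, map_mul, Module.End.mul_apply, T_f0, Tf0_apply, map_smul,
      Finsupp.smul_apply, h0, smul_zero, mul_zero]
  | zero =>
    have h : diagEntry q 0 = 0 := by
      funext n
      simp [diagEntry]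
    rw [h, Function.support_zero]
    exact Set.finite_empty
  | add x y _ _ hx hy =>
    rw [diagEntry_add]
    exact (hx.union hy).subset (Function.support_add _ _)
  | smul r x _ hx =>
    rw [diagEntry_smul]
    exact hx.subset (Function.support_const_smul_subset r _)

/-- The invariant integral `∫ f dν = (1 - q²) tr T(f (1 - z z*)⁻¹)` on finite functions. -/
def integral (q : Param) : DU q →ₗ[ℂ] ℂ where
  toFun f := (1 - qc q ^ 2) * ∑ᶠ n, diagEntry q f n
  map_add' f g := by
    rw [Submodule.coe_add, diagEntry_add]
    simp only [Pi.add_apply]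
    rw [finsum_add_distrib (finite_support_diagEntry f.2) (finite_support_diagEntry g.2), mul_add]
  map_smul' c f := by
    rw [Submodule.coe_smul, diagEntry_smul]
    simp only [Pi.smul_apply, RingHom.id_apply]
    rw [← smul_finsum' c (finite_support_diagEntry f.2)]
    simp only [smul_eq_mul]
    ring

/-! ### Distributions -/

/-- The space `D(U)_q'` of distributions, as antilinear functionals on finite functions. -/
abbrev Dist (q : Param) : Type := DU q →ₗ⋆[ℂ] ℂ

/-- A function `f` as a distribution: `ψ ↦ (f, ψ) = ∫ ψ* f dν`. -/
def toDist (q : Param) : FunU q →ₗ[ℂ] Dist q :=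
  LinearMap.mk₂'ₛₗ (RingHom.id ℂ) (starRingEnd ℂ)
    (fun f ψ => integral q ⟨star (ψ : FunU q) * f, mul_mem_DU_right f (star_mem_DU ψ.2)⟩)
    (fun f g ψ => by
      rw [← map_add]
      congr 1
      exact Subtype.ext (mul_add _ _ _))
    (fun c f ψ => by
      rw [RingHom.id_apply, ← map_smul]
      congr 1
      exact Subtype.ext (mul_smul_comm _ _ _))
    (fun f ψ χ => by
      rw [← map_add]
      congr 1
      apply Subtype.ext
      change star ((ψ : FunU q) + χ) * f = star (ψ : FunU q) * f + star (χ : FunU q) * f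
      rw [star_add, add_mul])
    (fun c f ψ => by
      rw [← map_smul]
      congr 1
      apply Subtype.ext
      change star (c • (ψ : FunU q)) * f = star c • (star (ψ : FunU q) * f)
      rw [star_smul, smul_mul_assoc])

/-! Polynomials are determined by their distributions, so that `Pol(ℂ)_q ⊂ D(U)_q'`. -/

theorem qc_pow_ne_one (q : Param) (n : ℕ) : (1 : ℂ) - qc q ^ (2 * (n + 1)) ≠ 0 := by
  have h : ((q : ℝ) ^ (2 * (n + 1)) : ℝ) < 1 := pow_lt_one₀ q.2.1.le q.2.2 (by omega)
  have h' : (1 : ℝ) - (q : ℝ) ^ (2 * (n + 1)) ≠ 0 := by linarith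
  unfold qc
  exact_mod_cast h'

theorem Tz_pow_v (n m : ℕ) : (Tz ^ n) (v m) = v (m + n) := by
  induction n with
  | zero => simp
  | succ n ih => rw [pow_succ', Module.End.mul_apply, ih, Tz_v, add_assoc]

theorem Tzs_apply (q : Param) (w : H) (n : ℕ) :
    (Tzs q w) n = (1 - qc q ^ (2 * (n + 1))) * w (n + 1) := by
  have h : (Finsupp.lapply n : H →ₗ[ℂ] ℂ).comp (Tzs q) =
      (1 - qc q ^ (2 * (n + 1))) • (Finsupp.lapply (n + 1) : H →ₗ[ℂ] ℂ) := by
    apply Finsupp.lhom_ext'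
    intro j
    apply LinearMap.ext_ring
    change (Tzs q (v j)) n = (1 - qc q ^ (2 * (n + 1))) * (v j) (n + 1)
    rw [Tzs_v]
    cases j with
    | zero => simp [v]
    | succ j =>
      by_cases hj : j = n
      · subst hj
        simp [v]
      · simp [v, hj]
  exact LinearMap.congr_fun h w

theorem Tzs_pow_apply_zero (q : Param) (a : ℕ) :
    ∃ c : ℂ, c ≠ 0 ∧ ∀ (w : H) (m : ℕ), m = 0 → ((Tzs q ^ a) w) m = c * w a := by
  induction a with
  | zero => exact ⟨1, one_ne_zero, fun w m hm => by simp [hm]⟩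
  | succ a ih =>
    obtain ⟨c, hc, h⟩ := ih
    refine ⟨c * (1 - qc q ^ (2 * (a + 1))), mul_ne_zero hc (qc_pow_ne_one q a), ?_⟩
    intro w m hm
    rw [pow_succ, Module.End.mul_apply, h _ _ hm, Tzs_apply, mul_assoc]

theorem T_eq_zero_of_toDist {q : Param} {g : FunU q} (hg : toDist q g = 0) : T q g = 0 := by
  apply end_ext
  intro b
  ext a
  have h := LinearMap.congr_fun hg ⟨z q ^ a * f0 q * zs q ^ b, mem_DU_gen _ _⟩
  change (1 - qc q ^ 2) * ∑ᶠ n, diagEntry q (star (z q ^ a * f0 q * zs q ^ b) * g) n = 0 at h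
  rw [mul_eq_zero, or_iff_right (one_sub_qc_sq_ne_zero q), star_mul, star_mul, star_pow, star_pow,
    star_z, star_zs, star_f0] at h
  obtain ⟨c, hc, hT⟩ := Tzs_pow_apply_zero q a
  have key : ∀ n, diagEntry q (z q ^ b * (f0 q * zs q ^ a) * g) n =
      if n = b then (qc q ^ (2 * b))⁻¹ * (c * (T q g (v b)) a) else 0 := by
    intro n
    simp only [diagEntry, map_mul, map_pow, Module.End.mul_apply, T_f0, T_z, T_zs, Tf0_apply,
      map_smul, Tz_pow_v, Finsupp.smul_apply, smul_eq_mul]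
    rw [hT _ 0 rfl, zero_add]
    by_cases hn : n = b
    · subst hn
      simp [v]
    · have hn' : (v b) n = 0 := Finsupp.single_eq_of_ne hn
      simp [hn, hn']
  rw [finsum_congr key, finsum_eq_single _ b (fun n hn => if_neg hn), if_pos rfl] at h
  have hq : (qc q ^ (2 * b))⁻¹ ≠ 0 := inv_ne_zero (pow_ne_zero _ (qc_ne_zero q))
  rw [mul_eq_zero, or_iff_right hq, mul_eq_zero, or_iff_right hc] at h
  simpa using h

/-- The span of the monomials `z^j z*^k`. -/
def monoSpan (q : Param) : Submodule ℂ (FunU q) :=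
  Submodule.span ℂ (Set.range fun p : ℕ × ℕ => z q ^ p.1 * zs q ^ p.2)

theorem zs_mul_z_pow (q : Param) (j : ℕ) : ∃ c d : ℂ,
    zs q * z q ^ (j + 1) = c • (z q ^ (j + 1) * zs q) + d • z q ^ j := by
  induction j with
  | zero =>
    refine ⟨qc q ^ 2, 1 - qc q ^ 2, ?_⟩
    rw [zero_add, pow_one, pow_zero, zs_mul_z, Algebra.algebraMap_eq_smul_one]
  | succ j ih =>
    obtain ⟨c, d, h⟩ := ih
    refine ⟨c * qc q ^ 2, c * (1 - qc q ^ 2) + d, ?_⟩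
    rw [pow_succ, ← mul_assoc, h, add_mul, smul_mul_assoc, smul_mul_assoc, mul_assoc, zs_mul_z,
      mul_add, ← Algebra.commutes, ← Algebra.smul_def, mul_smul_comm, ← mul_assoc, ← pow_succ,
      ← pow_succ, smul_add, smul_smul, smul_smul, add_smul, add_assoc]

theorem mem_monoSpan (q : Param) (j k : ℕ) : z q ^ j * zs q ^ k ∈ monoSpan q :=
  Submodule.subset_span ⟨(j, k), rfl⟩

theorem z_mul_mem {q : Param} {x : FunU q} (hx : x ∈ monoSpan q) : z q * x ∈ monoSpan q := by
  induction hx using Submodule.span_induction with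
  | mem x h =>
    obtain ⟨⟨j, k⟩, rfl⟩ := h
    have h := mem_monoSpan q (j + 1) k
    rwa [pow_succ', mul_assoc] at h
  | zero => rw [mul_zero]; exact zero_mem _
  | add x y _ _ hx hy => rw [mul_add]; exact add_mem hx hy
  | smul r x _ hx => rw [mul_smul_comm]; exact Submodule.smul_mem _ _ hx

theorem zs_mul_mem {q : Param} {x : FunU q} (hx : x ∈ monoSpan q) : zs q * x ∈ monoSpan q := by
  induction hx using Submodule.span_induction with
  | mem x h =>
    obtain ⟨⟨j, k⟩, rfl⟩ := h
    cases j with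
    | zero =>
      have h := mem_monoSpan q 0 (k + 1)
      rw [pow_zero, one_mul, pow_succ'] at h
      simpa using h
    | succ j =>
      obtain ⟨c, d, h⟩ := zs_mul_z_pow q j
      change zs q * (z q ^ (j + 1) * zs q ^ k) ∈ monoSpan q
      rw [← mul_assoc, h, add_mul, smul_mul_assoc, smul_mul_assoc, mul_assoc, ← pow_succ']
      exact add_mem (Submodule.smul_mem _ _ (mem_monoSpan q _ _))
        (Submodule.smul_mem _ _ (mem_monoSpan q _ _))
  | zero => rw [mul_zero]; exact zero_mem _
  | add x y _ _ hx hy => rw [mul_add]; exact add_mem hx hy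
  | smul r x _ hx => rw [mul_smul_comm]; exact Submodule.smul_mem _ _ hx

theorem Pol_le_monoSpan {q : Param} {x : FunU q} (hx : x ∈ Pol q) : x ∈ monoSpan q := by
  have h : ∀ w ∈ monoSpan q, x * w ∈ monoSpan q := by
    induction hx using Algebra.adjoin_induction with
    | mem x h =>
      rw [star_z] at h
      rcases h with rfl | h
      · exact fun w hw => z_mul_mem hw
      · rw [Set.mem_singleton_iff] at h
        subst h
        exact fun w hw => zs_mul_mem hw
    | algebraMap r =>
      intro w hw
      rw [← Algebra.smul_def]
      exact Submodule.smul_mem _ _ hw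
    | add x y _ _ hx hy =>
      intro w hw
      rw [add_mul]
      exact add_mem (hx w hw) (hy w hw)
    | mul x y _ _ hx hy =>
      intro w hw
      rw [mul_assoc]
      exact hx _ (hy w hw)
  have h1 := h 1 (by simpa using mem_monoSpan q 0 0)
  rwa [mul_one] at h1

theorem Tzs_pow_v (q : Param) (n k : ℕ) :
    (n < k → (Tzs q ^ k) (v n) = 0) ∧ ∃ c : ℂ, (k = n → c ≠ 0) ∧
      (Tzs q ^ k) (v n) = c • v (n - k) := by
  induction k generalizing n with
  | zero => exact ⟨fun h => absurd h (Nat.not_lt_zero _), 1, fun _ => one_ne_zero, by simp⟩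
  | succ k ih =>
    rw [pow_succ, Module.End.mul_apply, Tzs_v, map_smul]
    cases n with
    | zero =>
      refine ⟨fun _ => by simp, 0, fun h => absurd h (Nat.succ_ne_zero k), by simp⟩
    | succ n =>
      rw [Nat.add_sub_cancel]
      obtain ⟨h1, c, h2, h3⟩ := ih n
      refine ⟨fun h => ?_, (1 - qc q ^ (2 * (n + 1))) * c, fun h => ?_, ?_⟩
      · rw [h1 (by omega), smul_zero]
      · exact mul_ne_zero (qc_pow_ne_one q n) (h2 (by omega))
      · rw [h3, smul_smul, Nat.add_sub_add_right]

/-- The representation `T` is faithful on polynomials. -/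
theorem eq_zero_of_T {q : Param} {g : FunU q} (hg : g ∈ Pol q) (h : T q g = 0) : g = 0 := by
  obtain ⟨a, rfl⟩ := Finsupp.mem_span_range_iff_exists_finsupp.1 (Pol_le_monoSpan hg)
  suffices ha : ∀ k j, a (j, k) = 0 by
    have h0 : a = 0 := by
      ext ⟨j, k⟩
      exact ha k j
    rw [h0, Finsupp.sum_zero_index]
  intro k
  induction k using Nat.strong_induction_on with
  | _ k ih =>
    intro j
    obtain ⟨-, c, hc, hT⟩ := Tzs_pow_v q k k
    have h1 := DFunLike.congr_fun (LinearMap.congr_fun h (v k)) j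
    rw [Finsupp.sum, map_sum, LinearMap.sum_apply, Finsupp.finsetSum_apply] at h1
    have key : ∀ p ∈ a.support,
        (T q (a p • (z q ^ p.1 * zs q ^ p.2)) (v k)) j = if p = (j, k) then a (j, k) * c else 0 := by
      rintro ⟨j', k'⟩ -
      simp only [map_smul, map_mul, map_pow, LinearMap.smul_apply, Module.End.mul_apply, T_z, T_zs,
        Finsupp.smul_apply, smul_eq_mul]
      rcases lt_trichotomy k' k with hk | hk | hk
      · rw [ih k' hk j', zero_mul, if_neg]
        intro e
        rw [Prod.mk.injEq] at e
        omega
      · subst hk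
        rw [hT, map_smul, Tz_pow_v, Nat.sub_self, zero_add, Finsupp.smul_apply, smul_eq_mul]
        by_cases hj : j' = j
        · subst hj
          simp [v]
        · have h0 : (v j') j = 0 := Finsupp.single_eq_of_ne (Ne.symm hj)
          simp [h0, hj]
      · rw [(Tzs_pow_v q k k').1 hk, map_zero, if_neg]
        · simp
        · intro e
          rw [Prod.mk.injEq] at e
          omega
    rw [Finset.sum_congr rfl key, Finset.sum_ite_eq'] at h1
    by_cases hm : (j, k) ∈ a.support
    · rw [if_pos hm] at h1
      exact (mul_eq_zero.1 h1).resolve_right (hc rfl)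
    · exact Finsupp.notMem_support_iff.1 hm

/-- A polynomial is determined by its distribution. -/
theorem toDist_injOn (q : Param) : Set.InjOn (toDist q) (Pol q) := by
  intro f hf g hg h
  rw [← sub_eq_zero]
  apply eq_zero_of_T (sub_mem hf hg)
  apply T_eq_zero_of_toDist
  rw [map_sub, h, sub_self]

/-! ### The first order differential calculus

The bimodule of 1-forms is free as a left module with the basis `dz`, `dz*`, and
`dz · z = q² z dz`, `dz · z* = q⁻² z* dz`, `dz* · z = q² z dz*`, `dz* · z* = q⁻² z* dz*`,
`dz · f₀ = f₀ dz`, `dz* · f₀ = f₀ dz*`; that is `dz · f = τ(f) dz` and `dz* · f = τ(f) dz*`. -/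

/-- The algebra map `z ↦ c z`, `z* ↦ c⁻¹ z*`, `f₀ ↦ f₀`. -/
def scale (q : Param) (c : ℂ) (hc : c ≠ 0) : FunU q →ₐ[ℂ] FunU q :=
  lift q (c • z q) (c⁻¹ • zs q) (f0 q)
    (by
      simp only [smul_mul_assoc, mul_smul_comm, smul_smul, mul_inv_cancel₀ hc,
        inv_mul_cancel₀ hc, one_smul]
      exact zs_mul_z q)
    (by rw [smul_mul_assoc, zs_mul_f0, smul_zero])
    (by rw [mul_smul_comm, f0_mul_z, smul_zero])
    (f0_mul_f0 q)

/-- The twist `τ`: `z ↦ q² z`, `z* ↦ q⁻² z*`, `f₀ ↦ f₀`. -/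
def tau (q : Param) : FunU q →ₐ[ℂ] FunU q := scale q (qc q ^ 2) (pow_ne_zero _ (qc_ne_zero q))

/-- The inverse twist `z ↦ q⁻² z`, `z* ↦ q² z*`, `f₀ ↦ f₀`. -/
def tauInv (q : Param) : FunU q →ₐ[ℂ] FunU q :=
  scale q (qc q ^ 2)⁻¹ (inv_ne_zero (pow_ne_zero _ (qc_ne_zero q)))

theorem tau_z (q : Param) : tau q (z q) = qc q ^ 2 • z q := by
  unfold tau scale
  rw [lift_z]
theorem tau_zs (q : Param) : tau q (zs q) = (qc q ^ 2)⁻¹ • zs q := by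
  unfold tau scale
  rw [lift_zs]
theorem tau_f0 (q : Param) : tau q (f0 q) = f0 q := by
  unfold tau scale
  rw [lift_f0]
theorem tauInv_z (q : Param) : tauInv q (z q) = (qc q ^ 2)⁻¹ • z q := by
  unfold tauInv scale
  rw [lift_z]
theorem tauInv_zs (q : Param) : tauInv q (zs q) = ((qc q ^ 2)⁻¹)⁻¹ • zs q := by
  unfold tauInv scale
  rw [lift_zs]
theorem tauInv_f0 (q : Param) : tauInv q (f0 q) = f0 q := by
  unfold tauInv scale
  rw [lift_f0]

theorem tau_tauInv {q : Param} (f : FunU q) : tau q (tauInv q f) = f := by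
  have hq : qc q ^ 2 ≠ 0 := pow_ne_zero _ (qc_ne_zero q)
  have h : (tau q).comp (tauInv q) = AlgHom.id ℂ (FunU q) := by
    apply hom_ext
    · simp only [AlgHom.comp_apply, AlgHom.id_apply]
      rw [tauInv_z, map_smul, tau_z, smul_smul, inv_mul_cancel₀ hq, one_smul]
    · simp only [AlgHom.comp_apply, AlgHom.id_apply]
      rw [tauInv_zs, map_smul, tau_zs, smul_smul, inv_inv, mul_inv_cancel₀ hq, one_smul]
    · simp only [AlgHom.comp_apply, AlgHom.id_apply]
      rw [tauInv_f0, tau_f0]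
  exact DFunLike.congr_fun h f

/-- The 1-forms: the pair `(a, b)` is the form `a dz + b dz*`. The left multiplication by functions
is the obvious one. -/
abbrev Omega (q : Param) : Type := FunU q × FunU q

/-- The form `dz`. -/
def dz (q : Param) : Omega q := (1, 0)

/-- The form `dz*`. -/
def dzs (q : Param) : Omega q := (0, 1)

/-- The right multiplication of 1-forms by functions,
`(a dz + b dz*) · f = a τ(f) dz + b τ(f) dz*`. -/
def rmul {q : Param} (w : Omega q) (f : FunU q) : Omega q := (w.1 * tau q f, w.2 * tau q f)

theorem one_sub_smul_aux (q : Param) :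
    zs q * (z q * f0 q) = (1 - qc q ^ 2) • f0 q := by
  rw [← mul_assoc, zs_mul_z, add_mul, smul_mul_assoc, mul_assoc, zs_mul_f0, mul_zero, smul_zero,
    zero_add, ← Algebra.smul_def]

theorem one_sub_smul_aux' (q : Param) :
    f0 q * zs q * z q = (1 - qc q ^ 2) • f0 q := by
  rw [mul_assoc, zs_mul_z, mul_add, mul_smul_comm, ← mul_assoc, f0_mul_z, zero_mul, smul_zero,
    zero_add, ← Algebra.commutes, ← Algebra.smul_def]

/-- The element `∂⁽ʳ⁾f₀/∂z`; its value is forced by `f₀ z = 0` and the Leibniz rule. -/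
def delF0 (q : Param) : FunU q := (-((1 - qc q ^ 2)⁻¹ * (qc q ^ 2)⁻¹)) • (f0 q * zs q)

/-- The element `∂⁽ʳ⁾f₀/∂z*`; its value is forced by `z* f₀ = 0` and the Leibniz rule. -/
def dbarF0 (q : Param) : FunU q := (-(1 - qc q ^ 2)⁻¹) • (z q * f0 q)

/-- The algebra map `f ↦ !![f, h; 0, τ(f)]` where `h = ∂⁽ʳ⁾f/∂z`, that is `∂f = h dz`. Being
multiplicative means the Leibniz rule `∂(f g) = (∂f) g + f ∂g`; besides `∂z = dz`, `∂z* = 0`. -/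
def delMat (q : Param) : FunU q →ₐ[ℂ] Matrix (Fin 2) (Fin 2) (FunU q) :=
  lift q
    !![z q, 1; 0, tau q (z q)]
    !![zs q, 0; 0, tau q (zs q)]
    !![f0 q, delF0 q; 0, tau q (f0 q)]
    (by
      have hq : qc q ^ 2 ≠ 0 := pow_ne_zero _ (qc_ne_zero q)
      ext i j
      fin_cases i <;> fin_cases j
      · simp [-map_sub, -map_pow, Matrix.algebraMap_matrix_apply, zs_mul_z]
      · simp [-map_sub, -map_pow, Matrix.algebraMap_matrix_apply, tau_zs, smul_smul, hq]
      · simp [-map_sub, -map_pow, Matrix.algebraMap_matrix_apply]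
      · simp [-map_sub, -map_pow, Matrix.algebraMap_matrix_apply, ← map_mul, zs_mul_z])
    (by
      ext i j
      fin_cases i <;> fin_cases j
      · simp [zs_mul_f0]
      · simp [delF0, ← mul_assoc, zs_mul_f0]
      · simp
      · simp [← map_mul, zs_mul_f0])
    (by
      have hq : qc q ^ 2 ≠ 0 := pow_ne_zero _ (qc_ne_zero q)
      have hq' := one_sub_qc_sq_ne_zero q
      ext i j
      fin_cases i <;> fin_cases j
      · simp [f0_mul_z]
      · have h : (1 - qc q ^ 2)⁻¹ * (qc q ^ 2)⁻¹ * (qc q ^ 2 * (1 - qc q ^ 2)) = 1 := by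
          rw [mul_assoc, inv_mul_cancel_left₀ hq, inv_mul_cancel₀ hq']
        simp [delF0, tau_z, one_sub_smul_aux', smul_smul, h]
      · simp
      · simp [← map_mul, f0_mul_z])
    (by
      ext i j
      fin_cases i <;> fin_cases j
      · simp [f0_mul_f0]
      · have h : f0 q * (f0 q * zs q) = f0 q * zs q := by rw [← mul_assoc, f0_mul_f0]
        simp [delF0, tau_f0, h, mul_assoc, zs_mul_f0]
      · simp
      · simp [← map_mul, f0_mul_f0])

/-- The algebra map `f ↦ !![f, h; 0, τ(f)]` where `h = ∂⁽ʳ⁾f/∂z*`, that is `∂̄f = h dz*`. Being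
multiplicative means the Leibniz rule `∂̄(f g) = (∂̄f) g + f ∂̄g`; besides `∂̄z = 0`, `∂̄z* = dz*`. -/
def dbarMat (q : Param) : FunU q →ₐ[ℂ] Matrix (Fin 2) (Fin 2) (FunU q) :=
  lift q
    !![z q, 0; 0, tau q (z q)]
    !![zs q, 1; 0, tau q (zs q)]
    !![f0 q, dbarF0 q; 0, tau q (f0 q)]
    (by
      ext i j
      fin_cases i <;> fin_cases j
      · simp [-map_sub, -map_pow, Matrix.algebraMap_matrix_apply, zs_mul_z]
      · simp [-map_sub, -map_pow, Matrix.algebraMap_matrix_apply, tau_z]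
      · simp [-map_sub, -map_pow, Matrix.algebraMap_matrix_apply]
      · simp [-map_sub, -map_pow, Matrix.algebraMap_matrix_apply, ← map_mul, zs_mul_z])
    (by
      have hq' := one_sub_qc_sq_ne_zero q
      ext i j
      fin_cases i <;> fin_cases j
      · simp [zs_mul_f0]
      · simp [dbarF0, tau_f0, one_sub_smul_aux, smul_smul, hq']
      · simp
      · simp [← map_mul, zs_mul_f0])
    (by
      ext i j
      fin_cases i <;> fin_cases j
      · simp [f0_mul_z]
      · simp [dbarF0, tau_z, mul_assoc, f0_mul_z]
      · simp
      · simp [← map_mul, f0_mul_z])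
    (by
      ext i j
      fin_cases i <;> fin_cases j
      · simp [f0_mul_f0]
      · simp [dbarF0, tau_f0, ← mul_assoc, f0_mul_z]
        simp [mul_assoc, f0_mul_f0]
      · simp
      · simp [← map_mul, f0_mul_f0])

/-- The differential `∂`. -/
def del (q : Param) : FunU q →ₗ[ℂ] Omega q :=
  (LinearMap.inl ℂ (FunU q) (FunU q)).comp
    ((Matrix.entryLinearMap ℂ (FunU q) 0 1).comp (delMat q).toLinearMap)

/-- The differential `∂̄`. -/
def dbar (q : Param) : FunU q →ₗ[ℂ] Omega q :=
  (LinearMap.inr ℂ (FunU q) (FunU q)).comp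
    ((Matrix.entryLinearMap ℂ (FunU q) 0 1).comp (dbarMat q).toLinearMap)

/-- The right partial derivative `∂⁽ʳ⁾f/∂z`, given by `∂f = (∂⁽ʳ⁾f/∂z) dz`. -/
def delRz (q : Param) : FunU q →ₗ[ℂ] FunU q :=
  (LinearMap.fst ℂ (FunU q) (FunU q)).comp (del q)

/-- The right partial derivative `∂⁽ʳ⁾f/∂z*`, given by `∂̄f = (∂⁽ʳ⁾f/∂z*) dz*`. -/
def delRzs (q : Param) : FunU q →ₗ[ℂ] FunU q :=
  (LinearMap.snd ℂ (FunU q) (FunU q)).comp (dbar q)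

/-- The left partial derivative `∂⁽ˡ⁾f/∂z`, given by `∂f = dz (∂⁽ˡ⁾f/∂z)`; see `del_eq_rmul`.
As `dz h = τ(h) dz`, it is obtained from the right one through `τ⁻¹`. -/
def delLz (q : Param) : FunU q →ₗ[ℂ] FunU q := (tauInv q).toLinearMap.comp (delRz q)

theorem del_eq_smul {q : Param} (f : FunU q) : del q f = delRz q f • dz q := by
  apply Prod.ext
  · change delRz q f = delRz q f * 1
    rw [mul_one]
  · change (0 : FunU q) = delRz q f * 0
    rw [mul_zero]

theorem dbar_eq_smul {q : Param} (f : FunU q) : dbar q f = delRzs q f • dzs q := by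
  apply Prod.ext
  · change (0 : FunU q) = delRzs q f * 0
    rw [mul_zero]
  · change delRzs q f = delRzs q f * 1
    rw [mul_one]

theorem del_eq_rmul {q : Param} (f : FunU q) : del q f = rmul (dz q) (delLz q f) := by
  apply Prod.ext
  · change delRz q f = 1 * tau q (tauInv q (delRz q f))
    rw [tau_tauInv, one_mul]
  · change (0 : FunU q) = 0 * _
    rw [zero_mul]

theorem dbarMat_diag {q : Param} (f : FunU q) :
    (dbarMat q f) 0 0 = f ∧ (dbarMat q f) 1 0 = 0 ∧ (dbarMat q f) 1 1 = tau q f := by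
  obtain ⟨x, rfl⟩ := RingQuot.mkAlgHom_surjective ℂ (Rel q) f
  change (dbarMat q (proj q x)) 0 0 = proj q x ∧ (dbarMat q (proj q x)) 1 0 = 0 ∧
    (dbarMat q (proj q x)) 1 1 = tau q (proj q x)
  induction x using FreeAlgebra.induction with
  | grade0 r => simp [Matrix.algebraMap_matrix_apply]
  | grade1 x =>
    cases x
    · change (dbarMat q (z q)) 0 0 = z q ∧ (dbarMat q (z q)) 1 0 = 0 ∧
        (dbarMat q (z q)) 1 1 = tau q (z q)
      simp only [dbarMat]
      rw [lift_z]
      simp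
    · change (dbarMat q (zs q)) 0 0 = zs q ∧ (dbarMat q (zs q)) 1 0 = 0 ∧
        (dbarMat q (zs q)) 1 1 = tau q (zs q)
      simp only [dbarMat]
      rw [lift_zs]
      simp
    · change (dbarMat q (f0 q)) 0 0 = f0 q ∧ (dbarMat q (f0 q)) 1 0 = 0 ∧
        (dbarMat q (f0 q)) 1 1 = tau q (f0 q)
      simp only [dbarMat]
      rw [lift_f0]
      simp
  | mul a b ha hb =>
    obtain ⟨ha0, ha1, ha2⟩ := ha
    obtain ⟨hb0, hb1, hb2⟩ := hb
    simp [map_mul, Matrix.mul_apply, Fin.sum_univ_two, ha0, ha1, ha2, hb0, hb1, hb2]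
  | add a b ha hb =>
    obtain ⟨ha0, ha1, ha2⟩ := ha
    obtain ⟨hb0, hb1, hb2⟩ := hb
    simp [map_add, ha0, ha1, ha2, hb0, hb1, hb2]

theorem delRzs_mul {q : Param} (f g : FunU q) :
    delRzs q (f * g) = delRzs q f * tau q g + f * delRzs q g := by
  change (dbarMat q (f * g)) 0 1 = (dbarMat q f) 0 1 * tau q g + f * (dbarMat q g) 0 1
  rw [map_mul, Matrix.mul_apply, Fin.sum_univ_two, (dbarMat_diag f).1, (dbarMat_diag g).2.2,
    add_comm]

/-- The Leibniz rule for `∂̄`. -/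
theorem dbar_mul {q : Param} (f g : FunU q) :
    dbar q (f * g) = rmul (dbar q f) g + f • dbar q g := by
  apply Prod.ext
  · change (0 : FunU q) = 0 * _ + f * 0
    rw [zero_mul, mul_zero, add_zero]
  · exact delRzs_mul f g

theorem delMat_diag {q : Param} (f : FunU q) :
    (delMat q f) 0 0 = f ∧ (delMat q f) 1 0 = 0 ∧ (delMat q f) 1 1 = tau q f := by
  obtain ⟨x, rfl⟩ := RingQuot.mkAlgHom_surjective ℂ (Rel q) f
  change (delMat q (proj q x)) 0 0 = proj q x ∧ (delMat q (proj q x)) 1 0 = 0 ∧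
    (delMat q (proj q x)) 1 1 = tau q (proj q x)
  induction x using FreeAlgebra.induction with
  | grade0 r => simp [Matrix.algebraMap_matrix_apply]
  | grade1 x =>
    cases x
    · change (delMat q (z q)) 0 0 = z q ∧ (delMat q (z q)) 1 0 = 0 ∧
        (delMat q (z q)) 1 1 = tau q (z q)
      simp only [delMat]
      rw [lift_z]
      simp
    · change (delMat q (zs q)) 0 0 = zs q ∧ (delMat q (zs q)) 1 0 = 0 ∧
        (delMat q (zs q)) 1 1 = tau q (zs q)
      simp only [delMat]
      rw [lift_zs]
      simp
    · change (delMat q (f0 q)) 0 0 = f0 q ∧ (delMat q (f0 q)) 1 0 = 0 ∧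
        (delMat q (f0 q)) 1 1 = tau q (f0 q)
      simp only [delMat]
      rw [lift_f0]
      simp
  | mul a b ha hb =>
    obtain ⟨ha0, ha1, ha2⟩ := ha
    obtain ⟨hb0, hb1, hb2⟩ := hb
    simp [map_mul, Matrix.mul_apply, Fin.sum_univ_two, ha0, ha1, ha2, hb0, hb1, hb2]
  | add a b ha hb =>
    obtain ⟨ha0, ha1, ha2⟩ := ha
    obtain ⟨hb0, hb1, hb2⟩ := hb
    simp [map_add, ha0, ha1, ha2, hb0, hb1, hb2]

theorem delRz_mul {q : Param} (f g : FunU q) :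
    delRz q (f * g) = delRz q f * tau q g + f * delRz q g := by
  change (delMat q (f * g)) 0 1 = (delMat q f) 0 1 * tau q g + f * (delMat q g) 0 1
  rw [map_mul, Matrix.mul_apply, Fin.sum_univ_two, (delMat_diag f).1, (delMat_diag g).2.2,
    add_comm]

/-- The Leibniz rule for `∂`. -/
theorem del_mul {q : Param} (f g : FunU q) :
    del q (f * g) = rmul (del q f) g + f • del q g := by
  apply Prod.ext
  · exact delRz_mul f g
  · change (0 : FunU q) = 0 * _ + f * 0
    rw [zero_mul, mul_zero, add_zero]

/-- The values of the differentials on the generators `z`, `z*`. -/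
theorem del_gen (q : Param) : del q (z q) = dz q ∧ del q (star (z q)) = 0 ∧
    dbar q (z q) = 0 ∧ dbar q (star (z q)) = dzs q := by
  have h1 : (delMat q (z q)) 0 1 = 1 := by
    simp only [delMat]
    rw [lift_z]
    simp
  have h2 : (delMat q (zs q)) 0 1 = 0 := by
    simp only [delMat]
    rw [lift_zs]
    simp
  have h3 : (dbarMat q (z q)) 0 1 = 0 := by
    simp only [dbarMat]
    rw [lift_z]
    simp
  have h4 : (dbarMat q (zs q)) 0 1 = 1 := by
    simp only [dbarMat]
    rw [lift_zs]
    simp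
  rw [star_z]
  exact ⟨Prod.ext h1 rfl, Prod.ext h2 rfl, Prod.ext rfl h3, Prod.ext rfl h4⟩

theorem delRzs_f0 (q : Param) : delRzs q (f0 q) = dbarF0 q := by
  change (dbarMat q (f0 q)) 0 1 = _
  simp only [dbarMat]
  rw [lift_f0]
  simp

theorem delRzs_mem_DU {q : Param} {f : FunU q} (hf : f ∈ DU q) : delRzs q f ∈ DU q := by
  induction hf using Submodule.span_induction with
  | mem x h =>
    obtain ⟨a, b, rfl⟩ := h
    rw [delRzs_mul, delRzs_mul, delRzs_f0, tau_f0, dbarF0]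
    have h0 : f0 q ∈ DU q := by
      have h := mem_DU_gen (q := q) 1 1
      rwa [one_mul, mul_one] at h
    refine add_mem (mul_mem_DU_right _ (add_mem (mul_mem_DU_left _ h0) (mul_mem_DU_left _ ?_)))
      (mem_DU_gen _ _)
    exact Submodule.smul_mem _ _ (mul_mem_DU_left _ h0)
  | zero => rw [map_zero]; exact zero_mem _
  | add x y _ _ hx hy => rw [map_add]; exact add_mem hx hy
  | smul r x _ hx => rw [map_smul]; exact Submodule.smul_mem _ _ hx

/-! ### The Laplace–Beltrami operator

The scalar products on functions and on the forms of type `(0,1)` are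
`(f, ψ) = ∫ ψ* f dν` and `(f dz*, ψ dz*) = ∫ ψ* f (1 - z z*)² dν`, and `□ = -∂̄* ∂̄`. -/

/-- The scalar product `(f dz*, ψ dz*) = ∫ ψ* f (1 - z z*)² dν` with the test forms `ψ dz*`, as a
distribution. -/
def formPairing (q : Param) : FunU q →ₗ[ℂ] Dist q :=
  (toDist q).comp (LinearMap.mulRight ℂ (y q ^ 2))

/-- The operator `∂⁽ʳ⁾/∂z*` on finite functions. -/
def delRzsDU (q : Param) : DU q →ₗ[ℂ] DU q :=
  (delRzs q).restrict (fun _ hf => delRzs_mem_DU hf)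

/-- The Laplace–Beltrami operator `□ = -∂̄* ∂̄`: for a function `f`, the distribution `□f` is
determined by `(□f, ψ) = -(∂̄f, ∂̄ψ)` for all finite functions `ψ`. -/
def laplaceBeltrami (q : Param) : FunU q →ₗ[ℂ] Dist q where
  toFun f := -(formPairing q (delRzs q f)).comp (delRzsDU q)
  map_add' f g := by
    ext ψ
    simp [add_comm]
  map_smul' c f := by
    ext ψ
    simp

theorem laplaceBeltrami_apply (q : Param) (f : FunU q) (ψ : DU q) :
    laplaceBeltrami q f ψ = -integral q ⟨star (delRzs q ψ) * (delRzs q f * y q ^ 2),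
      mul_mem_DU_right _ (star_mem_DU (delRzs_mem_DU ψ.2))⟩ := rfl

end QuantumDisc

end

namespace QuantumDisc

/-! Put `y = 1 - z z*`. The twist `τ` of the bimodule of forms is conjugation by `y`, in the sense
`τ(f) y = y f` (`tau_mul_y`). So multiplying a partial derivative by `y` on the right turns its
twisted Leibniz rule into the ordinary one. The resulting derivations are inner: `(1 - q²)
(∂⁽ʳ⁾f/∂z*) y = [f, z]` and `(1 - q²) y (∂⁽ˡ⁾f/∂z) = [z*, f]` (`delRzs_mul_y`, `y_mul_delLz`).

The integral is a trace with weight `T(y)⁻¹`, so it is cyclic up to a twist: `∫ y h = ∫ h y` and `∫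
z* h = q² ∫ h z*` (`integral_y_mul`, `integral_zs_mul`). With `g = (∂⁽ʳ⁾f/∂z*) y`, one factor `y` of
the form pairing can be moved next to the starred derivative of `ψ`. This gives `(1 - q²) (∂̄f, ∂̄ψ)
= ∫ [z*, ψ*] g = ∫ ψ* (q² g z* - z* g)`, that is `(1 - q²) □f = z* g - q² g z*`
(`laplaceBeltrami_eq_toDist`).

For `f = a b` with `a = f₂(z*)`, `b = f₁(z)`, let `a'` be the derivative of `a`. As `z` commutes
with `b`, `g = a' y b`. As `z*` commutes with `a'` and `z* y = q² y z*`, the right side is `q² a' y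
[z*, b] = (1 - q²) q² a' y² (∂⁽ˡ⁾b/∂z)`. The factor `1 - q²` is nonzero and is cancelled only at the
end. -/

/-- Serves for the identities below whose sides are not algebra maps in `f`, such as commutators,
where `hom_ext` does not apply. -/
theorem FunU.induction {q : Param} {p : FunU q → Prop}
    (algebraMap : ∀ c : ℂ, p (algebraMap ℂ (FunU q) c)) (z : p (z q)) (zs : p (zs q))
    (f0 : p (f0 q)) (mul : ∀ a b, p a → p b → p (a * b)) (add : ∀ a b, p a → p b → p (a + b))
    (f : FunU q) : p f := by
  obtain ⟨x, rfl⟩ := RingQuot.mkAlgHom_surjective ℂ (Rel q) f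
  change p (proj q x)
  induction x using FreeAlgebra.induction with
  | grade0 r => rw [AlgHom.commutes]; exact algebraMap r
  | grade1 x =>
    cases x
    · exact z
    · exact zs
    · exact f0
  | mul a b ha hb => rw [map_mul]; exact mul _ _ ha hb
  | add a b ha hb => rw [map_add]; exact add _ _ ha hb

/-! ### Commutation relations with `y = 1 - z z*` -/

theorem y_def (q : Param) : y q = 1 - z q * zs q := by rw [y, star_z]

theorem star_y (q : Param) : star (y q) = y q := by
  rw [y_def, star_sub, star_one, star_mul, star_z, star_zs]

/-- Both `z z*` and `z* z` are affine in `y`; this is why `y` commutes with `z` and `z*` up to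
powers of `q²`. -/
theorem zs_mul_z_eq (q : Param) : zs q * z q = 1 - qc q ^ 2 • y q := by
  rw [zs_mul_z, y_def, smul_sub, Algebra.algebraMap_eq_smul_one, sub_smul, one_smul]
  abel

theorem y_mul_z (q : Param) : y q * z q = qc q ^ 2 • (z q * y q) := by
  have h : y q * z q = z q * (1 - zs q * z q) := by rw [y_def]; noncomm_ring
  rw [h, zs_mul_z_eq, sub_sub_cancel, mul_smul_comm]

theorem zs_mul_y (q : Param) : zs q * y q = qc q ^ 2 • (y q * zs q) := by
  have h : zs q * y q = (1 - zs q * z q) * zs q := by rw [y_def]; noncomm_ring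
  rw [h, zs_mul_z_eq, sub_sub_cancel, smul_mul_assoc]

theorem y_mul_f0 (q : Param) : y q * f0 q = f0 q := by
  rw [y_def, sub_mul, mul_assoc, zs_mul_f0, mul_zero, sub_zero, one_mul]

theorem f0_mul_y (q : Param) : f0 q * y q = f0 q := by
  rw [y_def, mul_sub, ← mul_assoc, f0_mul_z, zero_mul, sub_zero, mul_one]

/-- Source of the factor `1 - q²` in the inner derivation formulas: it is their instance on the
generator whose derivative is `1`. -/
theorem zs_z_commutator (q : Param) :
    zs q * z q - z q * zs q = (1 - qc q ^ 2) • y q := by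
  rw [zs_mul_z_eq, sub_smul, one_smul, y_def]
  abel

/-- The twist `τ` is the conjugation by `y`. -/
theorem tau_mul_y {q : Param} (f : FunU q) : tau q f * y q = y q * f := by
  have hq : qc q ^ 2 ≠ 0 := pow_ne_zero _ (qc_ne_zero q)
  induction f using FunU.induction with
  | algebraMap c => rw [AlgHom.commutes, Algebra.commutes]
  | z => rw [tau_z, smul_mul_assoc, y_mul_z]
  | zs => rw [tau_zs, smul_mul_assoc, zs_mul_y, inv_smul_smul₀ hq]
  | f0 => rw [tau_f0, f0_mul_y, y_mul_f0]
  | mul a b ha hb => rw [map_mul, mul_assoc, hb, ← mul_assoc, ha, mul_assoc]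
  | add a b ha hb => rw [map_add, add_mul, ha, hb, mul_add]

/-! ### The partial derivatives as inner derivations -/

theorem delRzs_z (q : Param) : delRzs q (z q) = 0 := congrArg Prod.snd (del_gen q).2.2.1

theorem delRzs_zs (q : Param) : delRzs q (zs q) = 1 := by
  have h := congrArg Prod.snd (del_gen q).2.2.2
  rwa [star_z] at h

theorem delRzs_algebraMap (q : Param) (c : ℂ) : delRzs q (algebraMap ℂ (FunU q) c) = 0 := by
  change (dbarMat q _) 0 1 = _
  rw [AlgHom.commutes]
  simp [Matrix.algebraMap_matrix_apply]

theorem delRz_z (q : Param) : delRz q (z q) = 1 := congrArg Prod.fst (del_gen q).1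

theorem delRz_zs (q : Param) : delRz q (zs q) = 0 := by
  have h := congrArg Prod.fst (del_gen q).2.1
  rwa [star_z] at h

theorem delRz_algebraMap (q : Param) (c : ℂ) : delRz q (algebraMap ℂ (FunU q) c) = 0 := by
  change (delMat q _) 0 1 = _
  rw [AlgHom.commutes]
  simp [Matrix.algebraMap_matrix_apply]

theorem delRz_f0 (q : Param) : delRz q (f0 q) = delF0 q := by
  change (delMat q (f0 q)) 0 1 = _
  simp only [delMat]
  rw [lift_f0]
  simp

/-- `∂⁽ʳ⁾f/∂z* · y` is the commutator of `f` and `z`, up to the factor `1 - q²`. -/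
theorem delRzs_mul_y {q : Param} (f : FunU q) :
    (1 - qc q ^ 2) • (delRzs q f * y q) = f * z q - z q * f := by
  have hq := one_sub_qc_sq_ne_zero q
  induction f using FunU.induction with
  | algebraMap c => rw [delRzs_algebraMap, zero_mul, smul_zero, Algebra.commutes, sub_self]
  | z => rw [delRzs_z, zero_mul, smul_zero, sub_self]
  | zs => rw [delRzs_zs, one_mul, zs_z_commutator]
  | f0 =>
    -- Since `f₀ z = 0`, only `-z f₀` survives in the commutator, which fits the constant in
    -- `dbarF0`.
    rw [delRzs_f0, dbarF0, smul_mul_assoc, smul_smul, mul_neg, mul_inv_cancel₀ hq, mul_assoc,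
      f0_mul_y, f0_mul_z, neg_one_smul, zero_sub]
  | mul a b ha hb =>
    -- Replacing `τ(b) y` by `y b` untwists the Leibniz rule, which then matches `[ab, z] = [a, z] b
    -- + a [b, z]`.
    rw [delRzs_mul, add_mul, mul_assoc, tau_mul_y, ← mul_assoc, mul_assoc a, smul_add,
      ← smul_mul_assoc, ha, ← mul_smul_comm, hb]
    noncomm_ring
  | add a b ha hb =>
    rw [map_add, add_mul, smul_add, ha, hb]
    noncomm_ring

/-- `∂⁽ʳ⁾f/∂z · y` is the commutator of `z*` and `f`, up to the factor `1 - q²`. -/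
theorem delRz_mul_y {q : Param} (f : FunU q) :
    (1 - qc q ^ 2) • (delRz q f * y q) = zs q * f - f * zs q := by
  have hq := one_sub_qc_sq_ne_zero q
  have hq' := qc_ne_zero q
  induction f using FunU.induction with
  | algebraMap c => rw [delRz_algebraMap, zero_mul, smul_zero, Algebra.commutes, sub_self]
  | z => rw [delRz_z, one_mul, zs_z_commutator]
  | zs => rw [delRz_zs, zero_mul, smul_zero, sub_self]
  | f0 =>
    -- Moving `z*` past `y` produces the `q²` that cancels the extra `q⁻²` in `delF0`; `z* f₀ = 0`
    -- leaves only `-f₀ z*`.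
    rw [delRz_f0, delF0, smul_mul_assoc, mul_assoc, zs_mul_y, mul_smul_comm, ← mul_assoc, f0_mul_y,
      smul_smul, smul_smul, zs_mul_f0, zero_sub, ← neg_one_smul ℂ]
    congr 1
    simp only [smul_eq_mul]
    field_simp
  | mul a b ha hb =>
    rw [delRz_mul, add_mul, mul_assoc, tau_mul_y, ← mul_assoc, mul_assoc a, smul_add,
      ← smul_mul_assoc, ha, ← mul_smul_comm, hb]
    noncomm_ring
  | add a b ha hb =>
    rw [map_add, add_mul, smul_add, ha, hb]
    noncomm_ring

/-- `y · ∂⁽ˡ⁾f/∂z` is the commutator of `z*` and `f`, up to the factor `1 - q²`. -/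
theorem y_mul_delLz {q : Param} (f : FunU q) :
    (1 - qc q ^ 2) • (y q * delLz q f) = zs q * f - f * zs q := by
  -- The left derivative is `τ⁻¹` of the right one, so carrying `y` across it turns one into the
  -- other.
  rw [← delRz_mul_y, ← tau_mul_y]
  change _ • (tau q (tauInv q (delRz q f)) * _) = _
  rw [tau_tauInv]

theorem commute_aeval {A : Type*} [Ring A] [Algebra ℂ A] (a : A) (p : ℂ[X]) :
    Commute a (aeval a p) := by
  have h := (Commute.all X p).map (aeval a)
  rwa [aeval_X] at h

/-- The derivative of a polynomial in `z*` is again one, because `τ` only rescales `z*` in the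
Leibniz rule. -/
theorem commute_zs_delRzs_aeval (q : Param) (p : ℂ[X]) :
    Commute (zs q) (delRzs q (aeval (zs q) p)) := by
  induction p using Polynomial.induction_on with
  | C a => rw [aeval_C, delRzs_algebraMap]; exact Commute.zero_right _
  | add p r hp hr => rw [map_add, map_add]; exact hp.add_right hr
  | monomial n a h =>
    rw [pow_succ, ← mul_assoc, map_mul, aeval_X, delRzs_mul, delRzs_zs, mul_one, tau_zs,
      mul_smul_comm]
    refine ((h.mul_right (Commute.refl _)).smul_right _).add_right ?_
    exact commute_aeval _ _

/-! ### Permuting factors under the invariant integral -/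

/-- Coordinate form of `T_y`, needed when `T(y)` acts on `T(h) v_n`, which is no longer a basis
vector. -/
theorem T_y_apply (q : Param) (w : H) (n : ℕ) : (T q (y q) w) n = qc q ^ (2 * n) * w n := by
  have h : (Finsupp.lapply n : H →ₗ[ℂ] ℂ).comp (T q (y q)) =
      qc q ^ (2 * n) • (Finsupp.lapply n : H →ₗ[ℂ] ℂ) := by
    apply Finsupp.lhom_ext'
    intro j
    apply LinearMap.ext_ring
    change (T q (y q) (v j)) n = qc q ^ (2 * n) * (v j) n
    rw [T_y]
    by_cases hj : j = n
    · subst hj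
      simp
    · simp [v, hj]
  exact LinearMap.congr_fun h w

theorem diagEntry_y_mul (q : Param) (h : FunU q) :
    diagEntry q (y q * h) = diagEntry q (h * y q) := by
  funext n
  simp only [diagEntry, map_mul, Module.End.mul_apply, T_y_apply, T_y, map_smul,
    Finsupp.smul_apply, smul_eq_mul]

/-- The coefficient `1 - q⁰` vanishes, so `T(z*)` kills `v_0` and the truncated index `0 - 1` is
harmless. This is the boundary term in the index shift. -/
theorem diagEntry_mul_zs_zero (q : Param) (h : FunU q) : diagEntry q (h * zs q) 0 = 0 := by
  simp [diagEntry, T_zs, Tzs_v]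

/-- Both sides contain the same matrix element of `T(h)`, from `v_n` to `v_{n+1}`, with the same
coefficient `1 - q^{2(n+1)}`. Only the weights `q^{-2n}` and `q^{-2(n+1)}` differ, and `q²` is their
ratio. -/
theorem diagEntry_zs_mul (q : Param) (h : FunU q) (n : ℕ) :
    diagEntry q (zs q * h) n = diagEntry q (qc q ^ 2 • (h * zs q)) (n + 1) := by
  have hq := qc_ne_zero q
  simp only [diagEntry, map_mul, map_smul, Module.End.mul_apply, T_zs, Tzs_apply, Tzs_v,
    LinearMap.smul_apply, Finsupp.smul_apply, smul_eq_mul, Nat.add_sub_cancel]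
  rw [mul_add 2 n 1, pow_add]
  field_simp
  ring

theorem finsum_eq_finsum_succ {M : Type*} [AddCommMonoid M] (f : ℕ → M) (h : f 0 = 0) :
    ∑ᶠ n, f n = ∑ᶠ n, f (n + 1) := by
  -- The shifted sum runs over the range of `Nat.succ`, which misses only the index `0`.
  rw [← finsum_mem_range (f := f) (g := Nat.succ) Nat.succ_injective]
  refine finsum_congr fun n => ?_
  cases n <;> simp [h]

theorem integral_y_mul {q : Param} {h : FunU q} (hh : h ∈ DU q) :
    integral q ⟨y q * h, mul_mem_DU_left _ hh⟩ = integral q ⟨h * y q, mul_mem_DU_right _ hh⟩ :=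
  congrArg (fun d : ℕ → ℂ => (1 - qc q ^ 2) * ∑ᶠ n, d n) (diagEntry_y_mul q h)

/-- Cyclicity of the trace, twisted by carrying `z*` past the weight: `T(y)⁻¹ T(z*) = q² T(z*)
T(y)⁻¹`. On diagonal entries this is a shift of the index by one. -/
theorem integral_zs_mul {q : Param} {h : FunU q} (hh : h ∈ DU q) :
    integral q ⟨zs q * h, mul_mem_DU_left _ hh⟩ =
      integral q ⟨qc q ^ 2 • (h * zs q), Submodule.smul_mem _ _ (mul_mem_DU_right _ hh)⟩ := by
  change _ * ∑ᶠ n, diagEntry q _ n = _ * ∑ᶠ n, diagEntry q _ n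
  rw [finsum_congr (diagEntry_zs_mul q h), ← finsum_eq_finsum_succ]
  rw [diagEntry_smul, Pi.smul_apply, diagEntry_mul_zs_zero, smul_zero]

/-! ### The Laplace–Beltrami operator -/

/-- Adjoint of `delRzs_mul_y`: `y` is self-adjoint, and `1 - q²` is unchanged because `q` is real.
It removes the derivative from the test function in the pairing of forms. -/
theorem y_mul_star_delRzs {q : Param} (f : FunU q) :
    (1 - qc q ^ 2) • (y q * star (delRzs q f)) = zs q * star f - star f * zs q := by
  have h := congrArg star (delRzs_mul_y f)
  rw [star_smul, star_mul, star_y, star_sub (f * z q), star_mul, star_mul, star_z] at h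
  rw [← h]
  congr 1
  rw [← starRingEnd_apply, map_sub, map_one, map_pow, star_qc]

/-- For every function `f`, the distribution `□f` is a function. -/
theorem laplaceBeltrami_eq_toDist {q : Param} (f : FunU q) :
    (1 - qc q ^ 2) • laplaceBeltrami q f = toDist q
      (zs q * (delRzs q f * y q) - qc q ^ 2 • (delRzs q f * y q * zs q)) := by
  ext ψ
  set g := delRzs q f * y q with hg
  have hψ := star_mem_DU ψ.2
  have hd := star_mem_DU (delRzs_mem_DU ψ.2)
  have hdg : star (delRzs q ψ) * g ∈ DU q := mul_mem_DU_right _ hd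
  have hψg : star (ψ : FunU q) * g ∈ DU q := mul_mem_DU_right _ hψ
  rw [LinearMap.smul_apply, laplaceBeltrami_apply, smul_neg]
  have h1 : star (delRzs q ψ) * (delRzs q f * y q ^ 2) = star (delRzs q ψ) * g * y q := by
    rw [hg, pow_two, mul_assoc, mul_assoc]
  -- Of the two factors `y`, one stays in `g` and the other moves cyclically to the front, beside
  -- the starred derivative of `ψ`.
  have h2 : integral q ⟨star (delRzs q ψ) * (delRzs q f * y q ^ 2), mul_mem_DU_right _ hd⟩ =
      integral q ⟨y q * (star (delRzs q ψ) * g), mul_mem_DU_left _ hdg⟩ := by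
    rw [integral_y_mul hdg]
    exact congrArg (integral q) (Subtype.ext h1)
  rw [h2, ← map_smul]
  -- The commutator `[z*, ψ*]` is split into two terms, each finite because `ψ*` is, so that they
  -- can be integrated separately.
  have h3 : ((1 - qc q ^ 2) • (⟨y q * (star (delRzs q ψ) * g), mul_mem_DU_left _ hdg⟩ : DU q)) =
      ⟨zs q * (star (ψ : FunU q) * g), mul_mem_DU_left _ hψg⟩ -
        ⟨star (ψ : FunU q) * (zs q * g), mul_mem_DU_right _ hψ⟩ := by
    apply Subtype.ext
    change (1 - qc q ^ 2) • (y q * (star (delRzs q ψ) * g)) =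
      zs q * (star (ψ : FunU q) * g) - star (ψ : FunU q) * (zs q * g)
    rw [← mul_assoc (y q), ← smul_mul_assoc, y_mul_star_delRzs, sub_mul, mul_assoc, mul_assoc]
  -- Moving the leading `z*` to the end, at the cost of `q²`, leaves `ψ*` in front of both terms: an
  -- integration by parts.
  rw [h3, map_sub, integral_zs_mul hψg, ← map_sub, ← map_neg]
  refine congrArg (integral q) (Subtype.ext ?_)
  change -(qc q ^ 2 • (star (ψ : FunU q) * g * zs q) - star (ψ : FunU q) * (zs q * g)) =
    star (ψ : FunU q) * (zs q * g - qc q ^ 2 • (g * zs q))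
  rw [mul_sub, mul_smul_comm, neg_sub, mul_assoc]

theorem laplaceBeltrami_aeval_mul_aeval (q : QuantumDisc.Param) (f₁ f₂ : ℂ[X]) :
    (1 - qc q ^ 2) • laplaceBeltrami q (aeval (zs q) f₂ * aeval (z q) f₁) =
      (1 - qc q ^ 2) • toDist q (qc q ^ 2 •
        (delRzs q (aeval (zs q) f₂) * y q ^ 2 * delLz q (aeval (z q) f₁))) := by
  set a := aeval (zs q) f₂ with ha
  set b := aeval (z q) f₁ with hb
  have hzb : z q * b = b * z q := commute_aeval (z q) f₁
  have hza : zs q * delRzs q a = delRzs q a * zs q := commute_zs_delRzs_aeval q f₂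
  -- As `z` commutes with `b`, `[ab, z] = [a, z] b`.
  have hg : delRzs q (a * b) * y q = delRzs q a * y q * b := by
    apply smul_right_injective _ (one_sub_qc_sq_ne_zero q)
    change _ • _ = _ • _
    rw [delRzs_mul_y, ← smul_mul_assoc, delRzs_mul_y, sub_mul, mul_assoc, mul_assoc, ← hzb,
      mul_assoc]
  rw [laplaceBeltrami_eq_toDist, hg, ← map_smul]
  congr 1
  -- The `q²` gained in passing `y` equals the one from the twisted trace, so the two terms combine
  -- into the untwisted commutator `[z*, b]`.
  have h1 : zs q * (delRzs q a * y q * b) = qc q ^ 2 • (delRzs q a * y q * (zs q * b)) := by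
    rw [← mul_assoc, ← mul_assoc, hza, mul_assoc (delRzs q a), zs_mul_y]
    simp only [mul_smul_comm, smul_mul_assoc, mul_assoc]
  rw [h1, ← smul_sub, smul_comm, mul_assoc _ b, ← mul_sub, ← y_mul_delLz, mul_smul_comm, pow_two (y q)]
  simp only [mul_assoc]

end QuantumDisc

theorem proposition8p3 (q : QuantumDisc.Param) (f₁ f₂ : ℂ[X]) :
    QuantumDisc.laplaceBeltrami q
        (aeval (star (QuantumDisc.z q)) f₂ * aeval (QuantumDisc.z q) f₁) =
      QuantumDisc.toDist q (((q : ℝ) : ℂ) ^ 2 •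
        (QuantumDisc.delRzs q (aeval (star (QuantumDisc.z q)) f₂) *
          (1 - QuantumDisc.z q * star (QuantumDisc.z q)) ^ 2 *
          QuantumDisc.delLz q (aeval (QuantumDisc.z q) f₁))) := by
  have h := QuantumDisc.laplaceBeltrami_aeval_mul_aeval q f₁ f₂
  rw [← QuantumDisc.star_z] at h
  -- `qc q` and `y q` agree with the explicit expressions of the goal by unfolding, so only `1 - q²`
  -- has to be cancelled.
  exact smul_right_injective _ (QuantumDisc.one_sub_qc_sq_ne_zero q) h
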